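/- Let $(\Omega,\mathcal F,\mathbb P)$ be a probability space. For sub-$\sigma$-fields $\mathcal A,\mathcal B$ put $\alpha(\mathcal A,\mathcal B)=\sup_{A\in\mathcal A,\,B\in\mathcal B}|\mathbb P(A\cap B)-\mathbb P(A)\mathbb P(B)|$, and for a time series $\{X_t\}_{t\in\mathbb Z}$ and $m=1,2,\ldots$ put $$\alpha(\{X_t\}_{t\in\mathbb Z};m)=\sup_{j\in\mathbb Z}\alpha\big(\sigma(\{X_t\}_{t\le j}),\sigma(\{X_t\}_{t\ge j+m})\big).$$ For each $n\in\mathbb N$ let $\{X_{t,n}\}_{t\in\mathbb Z}$ be a stationary Gaussian vector autoregressive process of order one in dimension $d_n$, that is, a strictly stationary $\mathbb R^{d_n}$-valued Gaussian process satisfying almost surely $$X_{t,n}=A_nX_{t-1,n}+E_{t,n},\qquad t\in\mathbb Z,$$ where $A_n\in\mathbb R^{d_n\times d_n}$ is a (deterministic) matrix and the innovations $\{E_{t,n}\}_{t\in\mathbb Z}$ are independent and identically distributed Gaussian vectors in $\mathbb R^{d_n}$. Let $\Sigma_n=\operatorname{Cov}(X_{0,n})$, let $\lambda_{\max}(\Sigma_n)$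 and $\lambda_{\min}(\Sigma_n)$ be its largest and smallest eigenvalues, and assume $\lambda_{\min}(\Sigma_n)>0$. Let $\|\cdot\|$ denote the matrix spectral norm. Then for every $n$ and every $m\ge 1$, $$\alpha(\{X_{t,n}\}_{t\in\mathbb Z};m)\le\Big\{\frac{\lambda_{\max}(\Sigma_n)}{\lambda_{\min}(\Sigma_n)}\Big\}^{1/2}\|A_n\|^m.$$ -/

import Mathlib

open MeasureTheory ProbabilityTheory

namespace GaussianVAR

/-- The `α`-mixing (strong mixing) coefficient of two `σ`-algebras `𝒜`, `ℬ` on a probability space: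
the supremum of `|P(A ∩ B) - P(A) P(B)|` over `A ∈ 𝒜` and `B ∈ ℬ`. -/
noncomputable def alphaCoeff {Ω : Type*} (𝒜 ℬ : MeasurableSpace Ω)
    [mΩ : MeasurableSpace Ω] (P : Measure Ω) : ℝ :=
  sSup {r : ℝ | ∃ A B : Set Ω, MeasurableSet[𝒜] A ∧ MeasurableSet[ℬ] B ∧
    r = |P.real (A ∩ B) - P.real A * P.real B|}

/-- The `σ`-algebra generated by the variables `X t`, `t ∈ T`. -/
abbrev sigmaGen {Ω S : Type*} [MeasurableSpace S] (X : ℤ → Ω → S) (T : Set ℤ) :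
    MeasurableSpace Ω :=
  ⨆ t ∈ T, MeasurableSpace.comap (X t) inferInstance

/-- The `α`-mixing coefficient at time gap `m` of a time series indexed by `ℤ`. -/
noncomputable def alphaMixing {Ω S : Type*} [MeasurableSpace Ω] [MeasurableSpace S]
    (P : Measure Ω) (X : ℤ → Ω → S) (m : ℕ) : ℝ :=
  ⨆ j : ℤ, alphaCoeff (sigmaGen X (Set.Iic j)) (sigmaGen X (Set.Ici (j + m))) P

/-- The covariance matrix of a random vector. -/
noncomputable def covMatrix {Ω : Type*} [MeasurableSpace Ω] {d : ℕ} (P : Measure Ω)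
    (Y : Ω → Fin d → ℝ) : Matrix (Fin d) (Fin d) ℝ :=
  Matrix.of fun i j => cov[fun ω => Y ω i, fun ω => Y ω j; P]

/-- The largest real eigenvalue of a matrix (used for covariance matrices, all of whose
eigenvalues are real). -/
noncomputable def lambdaMax {d : ℕ} (S : Matrix (Fin d) (Fin d) ℝ) : ℝ :=
  sSup {μ : ℝ | Module.End.HasEigenvalue (Matrix.toLin' S) μ}

/-- The smallest real eigenvalue of a matrix (used for covariance matrices, all of whose
eigenvalues are real). -/
noncomputable def lambdaMin {d : ℕ} (S : Matrix (Fin d) (Fin d) ℝ) : ℝ :=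
  sInf {μ : ℝ | Module.End.HasEigenvalue (Matrix.toLin' S) μ}

/-- The spectral norm of a matrix: its operator norm with respect to Euclidean norms. -/
noncomputable def matrixSpectralNorm {d : ℕ} (A : Matrix (Fin d) (Fin d) ℝ) : ℝ :=
  ‖Matrix.toEuclideanCLM (n := Fin d) (𝕜 := ℝ) A‖

/-- Strict stationarity: the law of the whole series is invariant under time shifts. -/
def IsStrictlyStationary {Ω S : Type*} [MeasurableSpace Ω] [MeasurableSpace S]
    (P : Measure Ω) (X : ℤ → Ω → S) : Prop :=
  ∀ h : ℤ, IdentDistrib (fun ω t => X (t + h) ω) (fun ω t => X t ω) P P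

/-- `X` is a stationary Gaussian vector autoregressive process of order one with transition
matrix `A` and innovations `E`: `X` is a (strictly) stationary Gaussian process, the innovations
are independent and identically distributed Gaussian vectors, and `X t = A X (t - 1) + E t`
almost surely for every time `t`. Means and covariances may be arbitrary, and
neither causality nor a bound on `A` is required. -/
structure IsStationaryGaussianVAR {Ω : Type*} [MeasurableSpace Ω] {d : ℕ} (P : Measure Ω)
    (A : Matrix (Fin d) (Fin d) ℝ) (X E : ℤ → Ω → Fin d → ℝ) : Prop where
  measurable_process : ∀ t, Measurable (X t)
  measurable_innovation : ∀ t, Measurable (E t)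
  gaussian_process : IsGaussianProcess X P
  stationary : IsStrictlyStationary P X
  gaussian_innovation : ∀ t, HasGaussianLaw (E t) P
  indep_innovation : iIndepFun E P
  identDistrib_innovation : ∀ s t, IdentDistrib (E s) (E t) P P
  recursion : ∀ t, ∀ᵐ ω ∂P, X t ω = A.mulVec (X (t - 1) ω) + E t ω

end GaussianVAR

/-! If `‖A‖ ≥ 1`, the right-hand side is at least `1`, since the eigenvalue ratio is, and there is
nothing to prove. Otherwise the process is causal, and the proof has two halves.

Linear half: with `s = j + m`, a linear variable `η` of the future has the same covariances with the
past as some `v ⬝ᵥ X s`, hence as `vAᵐ ⬝ᵥ X j`. Cauchy–Schwarz and the extreme eigenvalues of the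
stationary covariance give `cov[ξ, η]² ≤ ρ² Var ξ Var η`, with `ρ` the claimed bound
(`covariance_sq_le_of_mem_linSpan`).

Gaussian half: linear correlation controls all dependence (`abs_measureReal_inter_sub_le`). For
jointly Gaussian variables, the covariance of `exp ξ` and `exp η` is `E exp ξ · E exp η · (exp
cov[ξ, η] - 1)`. Expanding the last factor in a power series and applying the Schur product theorem
to each term transfers the correlation bound to linear combinations of exponentials
(`inner_sub_le_of_span`). Indicators are `L²` limits of these (`indicator_mem_closure_span_expSet`).
-/

namespace GaussianVAR

/-! ### Schur products and entrywise exponentials. -/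

/-- Entrywise powers preserve positivity of `H` and of `ρ H + F`, when `H` and `F` have disjoint
supports and `0 ≤ ρ ≤ 1`. -/
lemma posSemidef_map_pow {σ : Type*} {H F : Matrix σ σ ℝ} {ρ : ℝ} (h0 : 0 ≤ ρ)
    (h1 : ρ ≤ 1) (hH : H.PosSemidef) (hHF : (ρ • H + F).PosSemidef)
    (hdisj : ∀ a b, H a b * F a b = 0) (k : ℕ) :
    (H.map (· ^ (k + 1))).PosSemidef ∧
      (ρ • H.map (· ^ (k + 1)) + F.map (· ^ (k + 1))).PosSemidef := by
  induction k with
  | zero =>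
    have e (M : Matrix σ σ ℝ) : M.map (· ^ (0 + 1)) = M := by ext; simp
    rw [e, e]
    exact ⟨hH, hHF⟩
  | succ k ih =>
    have hpow : (H.map (· ^ (k + 1 + 1))).PosSemidef := by
      have e : H.map (· ^ (k + 1 + 1)) = (H.map (· ^ (k + 1))).hadamard H := by
        ext a b; simp [pow_succ]
      rw [e]
      exact ih.1.hadamard hH
    refine ⟨hpow, ?_⟩
    -- Disjoint supports kill the cross terms, so the Hadamard product yields `ρ ^ 2` in front of
    -- the power of `H`; the deficit `ρ - ρ ^ 2` is nonnegative.
    have e : ρ • H.map (· ^ (k + 1 + 1)) + F.map (· ^ (k + 1 + 1)) =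
        (ρ • H.map (· ^ (k + 1)) + F.map (· ^ (k + 1))).hadamard (ρ • H + F) +
          (ρ - ρ ^ 2) • H.map (· ^ (k + 1 + 1)) := by
      ext a b
      have h := hdisj a b
      simp only [Matrix.add_apply, Matrix.smul_apply, Matrix.map_apply, Matrix.hadamard_apply,
        smul_eq_mul]
      linear_combination (-ρ * H a b ^ k - ρ * F a b ^ k) * h
    rw [e]
    exact (ih.2.hadamard hHF).add (hpow.smul (by nlinarith))

/-- The quadratic form of a positive semidefinite real matrix, as a double sum. -/
lemma sum_sum_nonneg_of_posSemidef {σ : Type*} [Fintype σ] {M : Matrix σ σ ℝ}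
    (hM : M.PosSemidef) (x : σ → ℝ) : 0 ≤ ∑ a, ∑ b, x a * x b * M a b := by
  have h := hM.dotProduct_mulVec_nonneg x
  simp only [dotProduct, Matrix.mulVec, Finset.mul_sum, star_trivial] at h
  refine h.trans_eq (Finset.sum_congr rfl fun a _ ↦ Finset.sum_congr rfl fun b _ ↦ ?_)
  ring

/-- The series of `exp y - 1` has positive coefficients and no constant term, so the form is a
positive combination of those in `posSemidef_map_pow`. -/
lemma sum_sum_exp_nonneg {σ : Type*} [Fintype σ] {H F : Matrix σ σ ℝ} {ρ : ℝ} (h0 : 0 ≤ ρ)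
    (h1 : ρ ≤ 1) (hH : H.PosSemidef) (hHF : (ρ • H + F).PosSemidef)
    (hdisj : ∀ a b, H a b * F a b = 0) (x : σ → ℝ) :
    0 ≤ ∑ a, ∑ b, x a * x b *
      (ρ * (Real.exp (H a b) - 1) + (Real.exp (F a b) - 1)) := by
  have hexp (y : ℝ) : HasSum (fun k : ℕ ↦ y ^ (k + 1) / (k + 1).factorial) (Real.exp y - 1) := by
    have h := NormedSpace.expSeries_div_hasSum_exp y
    rw [← Real.exp_eq_exp_ℝ] at h
    simpa using (hasSum_nat_add_iff' 1).2 h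
  have hs : HasSum (fun k : ℕ ↦ ∑ a, ∑ b, x a * x b *
      (ρ * (H a b ^ (k + 1) / (k + 1).factorial) + F a b ^ (k + 1) / (k + 1).factorial))
      (∑ a, ∑ b, x a * x b * (ρ * (Real.exp (H a b) - 1) + (Real.exp (F a b) - 1))) :=
    hasSum_sum fun a _ ↦ hasSum_sum fun b _ ↦
      (((hexp _).mul_left ρ).add (hexp _)).mul_left _
  refine hs.nonneg fun k ↦ ?_
  have h := sum_sum_nonneg_of_posSemidef (posSemidef_map_pow h0 h1 hH hHF hdisj k).2 x
  have hk : (0 : ℝ) ≤ ((k + 1).factorial : ℝ)⁻¹ := by positivity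
  refine (mul_nonneg hk h).trans_eq ?_
  simp only [Finset.mul_sum, Matrix.add_apply, Matrix.smul_apply, Matrix.map_apply, smul_eq_mul]
  refine Finset.sum_congr rfl fun a _ ↦ Finset.sum_congr rfl fun b _ ↦ ?_
  ring

/-! ### Exponentials of variables in a Gaussian space. -/

section GaussianSpace

variable {Ω : Type*} [MeasurableSpace Ω] {P : Measure Ω}

lemma integral_exp_of_hasGaussianLaw {ξ : Ω → ℝ} (hξ : HasGaussianLaw ξ P) :
    ∫ ω, Real.exp (ξ ω) ∂P = Real.exp (P[ξ] + Var[ξ; P] / 2) := by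
  have h := mgf_gaussianReal hξ.map_eq_gaussianReal 1
  simpa [mgf, Real.coe_toNNReal _ (variance_nonneg ξ P)] using h

lemma integrable_exp_of_hasGaussianLaw {ξ : Ω → ℝ} (hξ : HasGaussianLaw ξ P) :
    Integrable (fun ω ↦ Real.exp (ξ ω)) P := by
  have := hξ.isProbabilityMeasure
  -- A nonintegrable function has integral `0` by convention, whereas the formula gives a positive
  -- value.
  refine Integrable.of_integral_ne_zero ?_
  rw [integral_exp_of_hasGaussianLaw hξ]
  positivity

lemma memLp_exp_of_hasGaussianLaw {ξ : Ω → ℝ} (hξ : HasGaussianLaw ξ P) :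
    MemLp (fun ω ↦ Real.exp (ξ ω)) 2 P := by
  have hm : AEMeasurable ξ P := hξ.aemeasurable
  rw [memLp_two_iff_integrable_sq (by fun_prop)]
  refine (integrable_exp_of_hasGaussianLaw (hξ.fun_smul 2)).congr (.of_forall fun ω ↦ ?_)
  simp [← Real.exp_nat_mul]

variable (P) in
/-- The elements of `L²` that are exponentials of variables in a given space. -/
def expSet (H : Submodule ℝ (Ω → ℝ)) : Set (Lp ℝ 2 P) :=
  {f | ∃ ξ ∈ H, f =ᵐ[P] fun ω ↦ Real.exp (ξ ω)}

variable {G H₁ H₂ : Submodule ℝ (Ω → ℝ)}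

/-- The sum `ξ + η` is Gaussian because `G` is a subspace, and its variance contributes the cross
term. Means enter only through the first two factors. -/
lemma integral_exp_mul_exp (hG : ∀ ξ ∈ G, HasGaussianLaw ξ P) {ξ η : Ω → ℝ}
    (hξ : ξ ∈ G) (hη : η ∈ G) :
    ∫ ω, Real.exp (ξ ω) * Real.exp (η ω) ∂P =
      (∫ ω, Real.exp (ξ ω) ∂P) * (∫ ω, Real.exp (η ω) ∂P) * Real.exp cov[ξ, η; P] := by
  have := (hG ξ hξ).isProbabilityMeasure
  have h := integral_exp_of_hasGaussianLaw (hG _ (G.add_mem hξ hη))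
  rw [variance_add (hG _ hξ).memLp_two (hG _ hη).memLp_two] at h
  simp only [Pi.add_apply, Real.exp_add] at h
  rw [integral_add (hG _ hξ).integrable (hG _ hη).integrable] at h
  rw [h, integral_exp_of_hasGaussianLaw (hG _ hξ), integral_exp_of_hasGaussianLaw (hG _ hη)]
  simp only [← Real.exp_add]
  ring_nf

lemma inner_of_expSet (hG : ∀ ξ ∈ G, HasGaussianLaw ξ P) {ξ η : Ω → ℝ}
    (hξ : ξ ∈ G) (hη : η ∈ G) {f g : Lp ℝ 2 P} (hf : f =ᵐ[P] fun ω ↦ Real.exp (ξ ω))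
    (hg : g =ᵐ[P] fun ω ↦ Real.exp (η ω)) :
    inner ℝ f g =
      (∫ ω, Real.exp (ξ ω) ∂P) * (∫ ω, Real.exp (η ω) ∂P) * Real.exp cov[ξ, η; P] := by
  rw [← integral_exp_mul_exp hG hξ hη, L2.inner_def]
  refine integral_congr_ae ?_
  filter_upwards [hf, hg] with ω h1 h2
  simp [h1, h2, mul_comm]

lemma inner_one_of_expSet (hG : ∀ ξ ∈ G, HasGaussianLaw ξ P) {ξ : Ω → ℝ}
    (hξ : ξ ∈ G) {f e : Lp ℝ 2 P} (hf : f =ᵐ[P] fun ω ↦ Real.exp (ξ ω))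
    (he : e =ᵐ[P] fun _ ↦ 1) :
    inner ℝ f e = ∫ ω, Real.exp (ξ ω) ∂P := by
  have := (hG ξ hξ).isProbabilityMeasure
  rw [inner_of_expSet hG hξ G.zero_mem hf (by simpa using he)]
  simp

lemma inner_sum_of_expSet (hG : ∀ ξ ∈ G, HasGaussianLaw ξ P) {ι κ : Type*} [Fintype ι]
    [Fintype κ] {ξ : ι → Ω → ℝ} {η : κ → Ω → ℝ} (hξ : ∀ i, ξ i ∈ G) (hη : ∀ j, η j ∈ G)
    {F : ι → Lp ℝ 2 P} {K : κ → Lp ℝ 2 P} (hF : ∀ i, F i =ᵐ[P] fun ω ↦ Real.exp (ξ i ω))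
    (hK : ∀ j, K j =ᵐ[P] fun ω ↦ Real.exp (η j ω)) (c : ι → ℝ) (d : κ → ℝ) :
    inner ℝ (∑ i, c i • F i) (∑ j, d j • K j) =
      ∑ i, ∑ j, (c i * ∫ ω, Real.exp (ξ i ω) ∂P) * (d j * ∫ ω, Real.exp (η j ω) ∂P) *
        Real.exp cov[ξ i, η j; P] := by
  rw [sum_inner]
  refine Finset.sum_congr rfl fun i _ ↦ ?_
  rw [inner_sum]
  refine Finset.sum_congr rfl fun j _ ↦ ?_
  rw [real_inner_smul_left, real_inner_smul_right, inner_of_expSet hG (hξ i) (hη j) (hF i) (hK j)]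
  ring

lemma covariance_sum_smul_sum_smul [IsFiniteMeasure P] {ι κ : Type*} [Fintype ι] [Fintype κ]
    {ξ : ι → Ω → ℝ} {η : κ → Ω → ℝ} (hξ : ∀ i, MemLp (ξ i) 2 P) (hη : ∀ j, MemLp (η j) 2 P)
    (c : ι → ℝ) (d : κ → ℝ) :
    cov[∑ i, c i • ξ i, ∑ j, d j • η j; P] = ∑ i, ∑ j, c i * d j * cov[ξ i, η j; P] := by
  rw [covariance_sum_sum (fun i ↦ (hξ i).const_smul _) (fun j ↦ (hη j).const_smul _)]
  refine Finset.sum_congr rfl fun i _ ↦ Finset.sum_congr rfl fun j _ ↦ ?_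
  rw [covariance_smul_left, covariance_smul_right, mul_assoc]

lemma variance_sum_smul [IsFiniteMeasure P] {ι : Type*} [Fintype ι]
    {ξ : ι → Ω → ℝ} (hξ : ∀ i, MemLp (ξ i) 2 P) (c : ι → ℝ) :
    Var[∑ i, c i • ξ i; P] = ∑ i, ∑ j, c i * c j * cov[ξ i, ξ j; P] := by
  rw [← covariance_self (memLp_finsetSum' _ fun i _ ↦ (hξ i).const_smul _).aemeasurable,
    covariance_sum_smul_sum_smul hξ hξ]

/-- The bound on covariances of a pair of subspaces of a Gaussian space carries over to the
linear combinations of exponentials of their elements. -/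
lemma inner_sub_le_of_span (hG : ∀ ξ ∈ G, HasGaussianLaw ξ P) (h₁ : H₁ ≤ G) (h₂ : H₂ ≤ G)
    {ρ : ℝ} (h0 : 0 ≤ ρ) (h1 : ρ ≤ 1)
    (hcov : ∀ ξ ∈ H₁, ∀ η ∈ H₂, 2 * cov[ξ, η; P] ≤ ρ * (Var[ξ; P] + Var[η; P]))
    {e : Lp ℝ 2 P} (he : e =ᵐ[P] fun _ ↦ 1) {f g : Lp ℝ 2 P}
    (hf : f ∈ Submodule.span ℝ (expSet P H₁)) (hg : g ∈ Submodule.span ℝ (expSet P H₂)) :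
    2 * (inner ℝ f g - inner ℝ f e * inner ℝ g e) ≤ ρ * (inner ℝ f f + inner ℝ g g) := by
  have hprob := (hG 0 G.zero_mem).isProbabilityMeasure
  obtain ⟨n, c, F, rfl⟩ := (Submodule.mem_span_set' ..).1 hf
  obtain ⟨m, d, K, rfl⟩ := (Submodule.mem_span_set' ..).1 hg
  choose ξ hξ hFξ using fun i ↦ (F i).2
  choose η hη hKη using fun i ↦ (K i).2
  have hL1 (i) : MemLp (ξ i) 2 P := (hG _ (h₁ (hξ i))).memLp_two
  have hL2 (i) : MemLp (η i) 2 P := (hG _ (h₂ (hη i))).memLp_two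
  -- `H` holds the covariances within the two families and `C` those across. Positivity of `ρ • H +
  -- C` is `hcov` read as a quadratic form.
  set H : Matrix (Fin n ⊕ Fin m) (Fin n ⊕ Fin m) ℝ :=
    .fromBlocks (.of fun i j ↦ cov[ξ i, ξ j; P]) 0 0 (.of fun i j ↦ cov[η i, η j; P])
  set C : Matrix (Fin n ⊕ Fin m) (Fin n ⊕ Fin m) ℝ :=
    .fromBlocks 0 (.of fun i j ↦ cov[ξ i, η j; P]) (.of fun j i ↦ cov[ξ i, η j; P]) 0
  have hHsymm : H.IsHermitian := by
    ext a b
    rcases a with a | a <;> rcases b with b | b <;> simp [H, covariance_comm]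
  have hCsymm : C.IsHermitian := by
    ext a b
    rcases a with a | a <;> rcases b with b | b <;> simp [C]
  have hquad (M : Matrix (Fin n ⊕ Fin m) (Fin n ⊕ Fin m) ℝ) (x) :
      star x ⬝ᵥ (M.mulVec x) = ∑ a, ∑ b, x a * x b * M a b := by
    simp only [dotProduct, Matrix.mulVec, Finset.mul_sum, star_trivial]
    exact Finset.sum_congr rfl fun a _ ↦ Finset.sum_congr rfl fun b _ ↦ by ring
  have hHquad (x : Fin n ⊕ Fin m → ℝ) : ∑ a, ∑ b, x a * x b * H a b =
      Var[∑ i, x (.inl i) • ξ i; P] + Var[∑ i, x (.inr i) • η i; P] := by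
    rw [variance_sum_smul hL1, variance_sum_smul hL2]
    simp [Fintype.sum_sum_type, H]
  have hCquad (x : Fin n ⊕ Fin m → ℝ) : ∑ a, ∑ b, x a * x b * C a b =
      2 * cov[∑ i, x (.inl i) • ξ i, ∑ i, x (.inr i) • η i; P] := by
    rw [covariance_sum_smul_sum_smul hL1 hL2, two_mul]
    simp only [Fintype.sum_sum_type, C, Matrix.fromBlocks_apply₁₁, Matrix.fromBlocks_apply₁₂,
      Matrix.fromBlocks_apply₂₁, Matrix.fromBlocks_apply₂₂, Matrix.zero_apply, Matrix.of_apply,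
      mul_zero, Finset.sum_const_zero, zero_add, add_zero]
    congr 1
    rw [Finset.sum_comm]
    exact Finset.sum_congr rfl fun a _ ↦ Finset.sum_congr rfl fun b _ ↦ by ring
  have hHpos : H.PosSemidef := by
    refine Matrix.PosSemidef.of_dotProduct_mulVec_nonneg hHsymm fun x ↦ ?_
    rw [hquad, hHquad]
    exact add_nonneg (variance_nonneg _ _) (variance_nonneg _ _)
  have hHC : (ρ • H + C).PosSemidef := by
    refine Matrix.PosSemidef.of_dotProduct_mulVec_nonneg
      ((hHsymm.smul (.all ρ)).add hCsymm) fun x ↦ ?_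
    have hξs : ∑ i, x (.inl i) • ξ i ∈ H₁ := H₁.sum_mem fun i _ ↦ H₁.smul_mem _ (hξ i)
    have hηs : ∑ i, x (.inr i) • η i ∈ H₂ := H₂.sum_mem fun i _ ↦ H₂.smul_mem _ (hη i)
    -- The sign of the first variable is flipped because the cross term must be bounded from below.
    have h := hcov _ (H₁.neg_mem hξs) _ hηs
    rw [covariance_neg_left, variance_neg, ← mul_neg_one, ← mul_assoc, ← hCquad, ← hHquad] at h
    rw [Matrix.add_mulVec, Matrix.smul_mulVec, dotProduct_add, dotProduct_smul, hquad, hquad,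
      smul_eq_mul]
    linarith
  have hdisj (a b) : H a b * C a b = 0 := by
    rcases a with a | a <;> rcases b with b | b <;> simp [H, C]
  -- The weights absorb the expectations of the exponentials; the minus sign on the second block
  -- makes the cross term an upper bound.
  have key := sum_sum_exp_nonneg h0 h1 hHpos hHC hdisj
    (Sum.elim (fun i ↦ c i * ∫ ω, Real.exp (ξ i ω) ∂P) fun j ↦ -(d j * ∫ ω, Real.exp (η j ω) ∂P))
  simp only [Fintype.sum_sum_type, H, C, Matrix.fromBlocks_apply₁₁, Matrix.fromBlocks_apply₁₂,
      Matrix.fromBlocks_apply₂₁, Matrix.fromBlocks_apply₂₂, Matrix.zero_apply, Matrix.of_apply,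
      Sum.elim_inl, Sum.elim_inr, Real.exp_zero, sub_self, mul_zero, zero_add, add_zero] at key
  have hfe : inner ℝ (∑ i, c i • (F i : Lp ℝ 2 P)) e = ∑ i, c i * ∫ ω, Real.exp (ξ i ω) ∂P := by
    simp only [sum_inner, real_inner_smul_left,
      fun i ↦ inner_one_of_expSet hG (h₁ (hξ i)) (hFξ i) he]
  have hge : inner ℝ (∑ i, d i • (K i : Lp ℝ 2 P)) e = ∑ i, d i * ∫ ω, Real.exp (η i ω) ∂P := by
    simp only [sum_inner, real_inner_smul_left,
      fun i ↦ inner_one_of_expSet hG (h₂ (hη i)) (hKη i) he]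
  rw [hfe, hge, inner_sum_of_expSet hG (fun i ↦ h₁ (hξ i)) (fun i ↦ h₁ (hξ i)) hFξ hFξ,
    inner_sum_of_expSet hG (fun i ↦ h₂ (hη i)) (fun i ↦ h₂ (hη i)) hKη hKη,
    inner_sum_of_expSet hG (fun i ↦ h₁ (hξ i)) (fun i ↦ h₂ (hη i)) hFξ hKη]
  set u := fun i ↦ c i * ∫ ω, Real.exp (ξ i ω) ∂P
  set v := fun i ↦ d i * ∫ ω, Real.exp (η i ω) ∂P
  have hsq {k l : ℕ} (x : Fin k → ℝ) (y : Fin l → ℝ) (E : Fin k → Fin l → ℝ) :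
      ∑ i, ∑ j, x i * y j * (E i j - 1) = ∑ i, ∑ j, x i * y j * E i j - (∑ i, x i) * ∑ j, y j := by
    simp only [mul_sub, mul_one, Finset.sum_sub_distrib, Finset.sum_mul_sum]
  have key' : 0 ≤ ρ * (∑ i, ∑ j, u i * u j * (Real.exp cov[ξ i, ξ j; P] - 1)) +
      ρ * (∑ i, ∑ j, v i * v j * (Real.exp cov[η i, η j; P] - 1)) -
      2 * ∑ i, ∑ j, u i * v j * (Real.exp cov[ξ i, η j; P] - 1) := by
    have hswap : ∑ i, ∑ j, v i * u j * (Real.exp cov[ξ j, η i; P] - 1) =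
        ∑ i, ∑ j, u i * v j * (Real.exp cov[ξ i, η j; P] - 1) := by
      rw [Finset.sum_comm]
      exact Finset.sum_congr rfl fun a _ ↦ Finset.sum_congr rfl fun b _ ↦ by ring
    refine key.trans_eq ?_
    simp only [Finset.sum_add_distrib, mul_neg, neg_mul, neg_neg, Finset.sum_neg_distrib,
      mul_left_comm _ ρ, ← Finset.mul_sum]
    rw [hswap]
    ring
  rw [hsq, hsq, hsq] at key'
  -- The bound holds with variances on the right; adding back the squared means only weakens it.
  nlinarith [mul_nonneg h0 (mul_self_nonneg (∑ i, u i)), mul_nonneg h0 (mul_self_nonneg (∑ i, v i))]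

end GaussianSpace

/-! ### Density of exponentials and the passage to events. -/

section Density

variable {Ω : Type*} [mΩ : MeasurableSpace Ω] {P : Measure Ω}

/-- Finite measures are determined by their moment-generating functions, if these are finite. -/
lemma map_eq_of_mgf_eq {μ ν : Measure Ω} [IsFiniteMeasure μ] [IsFiniteMeasure ν] {ξ : Ω → ℝ}
    (hξ : Measurable ξ) (hμ : ∀ t, Integrable (fun ω ↦ Real.exp (t * ξ ω)) μ)
    (h : mgf ξ μ = mgf ξ ν) : μ.map ξ = ν.map ξ := by
  have hzero : μ = 0 ↔ ν = 0 := by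
    have h0 := congrFun h 0
    simp only [mgf_zero'] at h0
    rw [← Measure.measure_univ_eq_zero, ← Measure.measure_univ_eq_zero, ← measureReal_eq_zero_iff,
      ← measureReal_eq_zero_iff, h0]
  have huniv : integrableExpSet ξ μ = Set.univ := Set.eq_univ_of_forall hμ
  refine Measure.ext_of_complexMGF_eq hξ.aemeasurable hξ.aemeasurable (funext fun z ↦ ?_)
  -- Analytic continuation from the real line; the strip of convergence is the whole plane.
  exact eqOn_complexMGF_of_mgf' h hzero (by simp [huniv])

variable {H : Submodule ℝ (Ω → ℝ)}

/-- Two finite measures agree on the `σ`-algebra generated by a linear space of random variables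
if they integrate the exponentials of these variables alike. -/
lemma measure_eq_of_integral_exp_eq {μ ν : Measure Ω} [IsFiniteMeasure μ] [IsFiniteMeasure ν]
    (hm : ∀ ξ ∈ H, Measurable ξ) (hμ : ∀ ξ ∈ H, Integrable (fun ω ↦ Real.exp (ξ ω)) μ)
    (h : ∀ ξ ∈ H, ∫ ω, Real.exp (ξ ω) ∂μ = ∫ ω, Real.exp (ξ ω) ∂ν) {A : Set Ω}
    (hA : MeasurableSet[⨆ ξ : H, MeasurableSpace.comap (ξ : Ω → ℝ) inferInstance] A) :
    μ A = ν A := by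
  classical
  have h1 (ξ) (hξ : ξ ∈ H) : μ.map ξ = ν.map ξ :=
    map_eq_of_mgf_eq (hm ξ hξ) (fun t ↦ hμ _ (H.smul_mem t hξ))
      (funext fun t ↦ h _ (H.smul_mem t hξ))
  let Φ : Ω → H → ℝ := fun ω ξ ↦ (ξ : Ω → ℝ) ω
  have hΦ : Measurable Φ := measurable_pi_lambda _ fun ξ ↦ hm ξ ξ.2
  have hmap : μ.map Φ = ν.map Φ := by
    -- Finite-dimensional marginals suffice. By Cramér–Wold they are determined by linear
    -- functionals of the coordinates, which again lie in `H`.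
    refine IsProjectiveLimit.unique (P := fun I ↦ (μ.map Φ).map I.restrict) (fun I ↦ rfl)
      fun I ↦ ?_
    beta_reduce
    rw [Measure.map_map (Finset.measurable_restrict I) hΦ,
      Measure.map_map (Finset.measurable_restrict I) hΦ]
    refine Measure.ext_of_charFunDual (funext fun L ↦ ?_)
    have hL : (fun ω ↦ L (I.restrict (Φ ω))) ∈ H := by
      have e : (fun ω ↦ L (I.restrict (Φ ω))) =
          ∑ i : I, L (Pi.single i 1) • ((i : H) : Ω → ℝ) := by
        ext ω
        rw [← Finset.univ_sum_single (I.restrict (Φ ω)), map_sum, Finset.sum_apply]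
        refine Finset.sum_congr rfl fun i _ ↦ ?_
        rw [Pi.smul_apply, smul_eq_mul, mul_comm, ← smul_eq_mul, ← map_smul, ← Pi.single_smul]
        simp [Φ]
      rw [e]
      exact H.sum_mem fun i _ ↦ H.smul_mem _ (i : H).2
    have hmeas : Measurable (I.restrict ∘ Φ) := (Finset.measurable_restrict I).comp hΦ
    have key (κ : Measure Ω) : charFunDual (κ.map (I.restrict ∘ Φ)) L =
        ∫ x : ℝ, Complex.exp (x * Complex.I) ∂(κ.map fun ω ↦ L (I.restrict (Φ ω))) := by
      rw [charFunDual_apply, integral_map hmeas.aemeasurable (by fun_prop),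
        integral_map (hm _ hL).aemeasurable (by fun_prop)]
      rfl
    rw [key, key, h1 _ hL]
  have hA' : MeasurableSet[MeasurableSpace.comap Φ inferInstance] A := by
    convert hA
    simp [MeasurableSpace.pi, MeasurableSpace.comap_iSup, MeasurableSpace.comap_comp, Φ,
      Function.comp_def]
  obtain ⟨B, hB, rfl⟩ := hA'
  rw [← Measure.map_apply hΦ hB, ← Measure.map_apply hΦ hB, hmap]

/-- An element of `L²` orthogonal to the exponentials of the variables in a linear space of
Gaussian variables integrates to zero over the events these variables generate. -/
lemma setIntegral_eq_zero_of_orthogonal (hm : ∀ ξ ∈ H, Measurable ξ)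
    (hH : ∀ ξ ∈ H, HasGaussianLaw ξ P) {h : Ω → ℝ} (hh : MemLp h 2 P)
    (horth : ∀ ξ ∈ H, ∫ ω, Real.exp (ξ ω) * h ω ∂P = 0) {A : Set Ω}
    (hA : MeasurableSet[⨆ ξ : H, MeasurableSpace.comap (ξ : Ω → ℝ) inferInstance] A) :
    ∫ ω in A, h ω ∂P = 0 := by
  have := (hH 0 H.zero_mem).isProbabilityMeasure
  have hint : Integrable h P := hh.integrable (by norm_num)
  have hle : (⨆ ξ : H, MeasurableSpace.comap (ξ : Ω → ℝ) inferInstance) ≤ mΩ :=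
    iSup_le fun ξ ↦ (hm ξ ξ.2).comap_le
  have hexp (ξ) (hξ : ξ ∈ H) : Integrable (fun ω ↦ Real.exp (ξ ω) * h ω) P :=
    (memLp_exp_of_hasGaussianLaw (hH ξ hξ)).integrable_mul hh
  -- `d 1` and `d (-1)` are the positive and negative parts of `h`; orthogonality says that the two
  -- measures integrate the exponentials alike.
  let d (s : ℝ) (ω : Ω) : ENNReal := ENNReal.ofReal (s * h ω)
  have hd (s) : AEMeasurable (d s) P := by
    have := hint.aemeasurable
    fun_prop
  have hfin (s : ℝ) : IsFiniteMeasure (P.withDensity (d s)) :=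
    isFiniteMeasure_withDensity_ofReal (hint.const_mul s).2
  have hpair (f : Ω → ℝ) (s) : ∫ ω, f ω ∂P.withDensity (d s) =
      ∫ ω, max (s * h ω) 0 * f ω ∂P := by
    rw [integral_withDensity_eq_integral_toReal_smul₀ (hd s) (.of_forall fun _ ↦ by simp [d])]
    simp [d, ENNReal.toReal_ofReal']
  have hpint (f : Ω → ℝ) (hf : AEStronglyMeasurable f P)
      (hfh : Integrable (fun ω ↦ f ω * h ω) P) (s : ℝ) :
      Integrable (fun ω ↦ max (s * h ω) 0 * f ω) P := by
    have := hint.aestronglyMeasurable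
    refine (hfh.const_mul s).mono (by fun_prop) (.of_forall fun ω ↦ ?_)
    have : |max (s * h ω) 0| ≤ |s * h ω| := by
      rw [abs_of_nonneg (le_max_right _ _)]
      exact max_le (le_abs_self _) (abs_nonneg _)
    calc ‖max (s * h ω) 0 * f ω‖ = |max (s * h ω) 0| * |f ω| := by simp
      _ ≤ |s * h ω| * |f ω| := by gcongr
      _ = ‖s * (f ω * h ω)‖ := by simp only [abs_mul, norm_mul, Real.norm_eq_abs]; ring
  have hdiff (f : Ω → ℝ) (hf : AEStronglyMeasurable f P)
      (hfh : Integrable (fun ω ↦ f ω * h ω) P) :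
      ∫ ω, f ω ∂P.withDensity (d 1) - ∫ ω, f ω ∂P.withDensity (d (-1)) =
        ∫ ω, f ω * h ω ∂P := by
    rw [hpair, hpair, ← integral_sub (hpint f hf hfh _) (hpint f hf hfh _)]
    refine integral_congr_ae (.of_forall fun ω ↦ ?_)
    rcases le_total (h ω) 0 with h0 | h0 <;> simp [h0] <;> ring
  have hAeq : P.withDensity (d 1) A = P.withDensity (d (-1)) A := by
    refine measure_eq_of_integral_exp_eq (H := H) hm (fun ξ hξ ↦ ?_) (fun ξ hξ ↦ ?_) hA
    · rw [integrable_withDensity_iff_integrable_smul₀' (hd 1) (.of_forall fun _ ↦ by simp [d])]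
      refine (hpint _ ((hm ξ hξ).exp.aestronglyMeasurable) (hexp ξ hξ) 1).congr
        (.of_forall fun ω ↦ ?_)
      simp [d, ENNReal.toReal_ofReal']
    · exact sub_eq_zero.1
        ((hdiff _ ((hm ξ hξ).exp.aestronglyMeasurable) (hexp ξ hξ)).trans (horth ξ hξ))
  have hAm : MeasurableSet A := hle A hA
  have h1 := hdiff (A.indicator 1) ((measurable_one.indicator hAm).aestronglyMeasurable)
    ((hint.indicator hAm).congr (.of_forall fun ω ↦ by by_cases hω : ω ∈ A <;> simp [hω]))
  rw [integral_indicator_one hAm, integral_indicator_one hAm, measureReal_def, measureReal_def,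
    hAeq, sub_self] at h1
  rw [← integral_indicator hAm, h1]
  refine integral_congr_ae (.of_forall fun ω ↦ ?_)
  by_cases hω : ω ∈ A <;> simp [hω]

/-- Indicators of the events generated by a linear space of Gaussian variables are limits in `L²`
of linear combinations of exponentials of these variables. -/
lemma indicator_mem_closure_span_expSet [IsFiniteMeasure P] (hm : ∀ ξ ∈ H, Measurable ξ)
    (hH : ∀ ξ ∈ H, HasGaussianLaw ξ P) {A : Set Ω}
    (hA : MeasurableSet[⨆ ξ : H, MeasurableSpace.comap (ξ : Ω → ℝ) inferInstance] A)
    (hAm : MeasurableSet A) :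
    indicatorConstLp 2 hAm (measure_ne_top P A) (1 : ℝ) ∈
      closure (Submodule.span ℝ (expSet P H) : Set (Lp ℝ 2 P)) := by
  rw [← Submodule.topologicalClosure_coe, SetLike.mem_coe,
    ← Submodule.orthogonal_orthogonal_eq_closure, Submodule.mem_orthogonal]
  intro h hh
  rw [real_inner_comm, L2.inner_indicatorConstLp_one]
  refine setIntegral_eq_zero_of_orthogonal hm hH (Lp.memLp h) (fun ξ hξ ↦ ?_) hA
  have hL := memLp_exp_of_hasGaussianLaw (hH ξ hξ)
  have h0 := (Submodule.mem_orthogonal _ _).1 hh (hL.toLp _)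
    (Submodule.subset_span ⟨ξ, hξ, hL.coeFn_toLp⟩)
  rw [← h0, L2.inner_def]
  refine integral_congr_ae ?_
  filter_upwards [hL.coeFn_toLp] with ω hω
  simp [hω, mul_comm]

lemma abs_measureReal_inter_sub_le_one [IsProbabilityMeasure P] (A B : Set Ω) :
    |P.real (A ∩ B) - P.real A * P.real B| ≤ 1 := by
  have hA0 : 0 ≤ P.real A := measureReal_nonneg
  have hB0 : 0 ≤ P.real B := measureReal_nonneg
  have hA1 : P.real A ≤ 1 := measureReal_le_one
  have hB1 : P.real B ≤ 1 := measureReal_le_one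
  have h0 : 0 ≤ P.real (A ∩ B) := measureReal_nonneg
  have h1 : P.real (A ∩ B) ≤ 1 := measureReal_le_one
  exact abs_le.2 ⟨by nlinarith, by nlinarith⟩

/-- **Kolmogorov–Rozanov inequality**: a bound on the linear correlation between two subspaces
of a Gaussian space bounds the dependence of the `σ`-algebras they generate. -/
lemma abs_measureReal_inter_sub_le {G H₁ H₂ : Submodule ℝ (Ω → ℝ)} [IsProbabilityMeasure P]
    (hm : ∀ ξ ∈ G, Measurable ξ) (hG : ∀ ξ ∈ G, HasGaussianLaw ξ P) (h₁ : H₁ ≤ G) (h₂ : H₂ ≤ G)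
    {ρ : ℝ} (h0 : 0 ≤ ρ)
    (hcov : ∀ ξ ∈ H₁, ∀ η ∈ H₂, 2 * cov[ξ, η; P] ≤ ρ * (Var[ξ; P] + Var[η; P]))
    {A B : Set Ω}
    (hA : MeasurableSet[⨆ ξ : H₁, MeasurableSpace.comap (ξ : Ω → ℝ) inferInstance] A)
    (hB : MeasurableSet[⨆ ξ : H₂, MeasurableSpace.comap (ξ : Ω → ℝ) inferInstance] B) :
    |P.real (A ∩ B) - P.real A * P.real B| ≤ ρ := by
  have hAm : MeasurableSet A := (iSup_le fun ξ : H₁ ↦ (hm ξ (h₁ ξ.2)).comap_le) A hA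
  have hBm : MeasurableSet B := (iSup_le fun ξ : H₂ ↦ (hm ξ (h₂ ξ.2)).comap_le) B hB
  rcases le_or_gt 1 ρ with h1 | h1
  · exact (abs_measureReal_inter_sub_le_one A B).trans h1
  set e : Lp ℝ 2 P := indicatorConstLp 2 MeasurableSet.univ (measure_ne_top P _) (1 : ℝ)
  have he : e =ᵐ[P] fun _ ↦ 1 := by
    filter_upwards [indicatorConstLp_coeFn (p := 2) (hs := MeasurableSet.univ)
      (hμs := measure_ne_top P _) (c := (1 : ℝ))] with ω hω
    rw [hω, Set.indicator_univ]
  set f : Lp ℝ 2 P := indicatorConstLp 2 hAm (measure_ne_top P A) (1 : ℝ)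
  set g : Lp ℝ 2 P := indicatorConstLp 2 hBm (measure_ne_top P B) (1 : ℝ)
  have hf : f ∈ closure (Submodule.span ℝ (expSet P H₁) : Set (Lp ℝ 2 P)) :=
    indicator_mem_closure_span_expSet (fun ξ hξ ↦ hm ξ (h₁ hξ)) (fun ξ hξ ↦ hG ξ (h₁ hξ)) hA hAm
  have hg : g ∈ closure (Submodule.span ℝ (expSet P H₂) : Set (Lp ℝ 2 P)) :=
    indicator_mem_closure_span_expSet (fun ξ hξ ↦ hm ξ (h₂ hξ)) (fun ξ hξ ↦ hG ξ (h₂ hξ)) hB hBm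
  have hclosed : IsClosed {x : Lp ℝ 2 P × Lp ℝ 2 P |
      2 * (inner ℝ x.1 x.2 - inner ℝ x.1 e * inner ℝ x.2 e) ≤
        ρ * (inner ℝ x.1 x.1 + inner ℝ x.2 x.2)} :=
    isClosed_le (by fun_prop) (by fun_prop)
  have hspan : ∀ x ∈ (Submodule.span ℝ (expSet P H₁) : Set (Lp ℝ 2 P)) ×ˢ
      (Submodule.span ℝ (expSet P H₂) : Set (Lp ℝ 2 P)),
      2 * (inner ℝ x.1 x.2 - inner ℝ x.1 e * inner ℝ x.2 e) ≤
        ρ * (inner ℝ x.1 x.1 + inner ℝ x.2 x.2) := fun x hx ↦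
    inner_sub_le_of_span hG h₁ h₂ h0 h1.le hcov he hx.1 hx.2
  have key {f' g' : Lp ℝ 2 P} (hf' : f' ∈ closure (Submodule.span ℝ (expSet P H₁) : Set _))
      (hg' : g' ∈ closure (Submodule.span ℝ (expSet P H₂) : Set (Lp ℝ 2 P))) :
      2 * (inner ℝ f' g' - inner ℝ f' e * inner ℝ g' e) ≤
        ρ * (inner ℝ f' f' + inner ℝ g' g') := by
    refine closure_minimal hspan hclosed (?_ : (f', g') ∈ _)
    rw [closure_prod_eq]
    exact ⟨hf', hg'⟩
  -- Replacing `f` by `-f` gives the other half of the absolute value.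
  have hneg : -f ∈ closure (Submodule.span ℝ (expSet P H₁) : Set (Lp ℝ 2 P)) := by
    rw [← Submodule.topologicalClosure_coe] at hf ⊢
    exact neg_mem hf
  have hin {S T : Set Ω} (hS : MeasurableSet S) (hT : MeasurableSet T) :
      inner ℝ (indicatorConstLp 2 hS (measure_ne_top P S) (1 : ℝ))
        (indicatorConstLp 2 hT (measure_ne_top P T) (1 : ℝ)) = P.real (S ∩ T) := by
    rw [L2.real_inner_indicatorConstLp_one_indicatorConstLp_one]
  have k1 := key hf hg
  have k2 := key hneg hg
  simp only [inner_neg_left, inner_neg_right, neg_neg] at k2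
  simp only [f, g, e, hin, Set.inter_univ, Set.inter_self] at k1 k2
  have hA1 : P.real A ≤ 1 := measureReal_le_one
  have hB1 : P.real B ≤ 1 := measureReal_le_one
  have hle : ρ * (P.real A + P.real B) ≤ ρ * 2 := by gcongr; linarith
  exact abs_le.2 ⟨by linarith, by linarith⟩

end Density

/-! ### Rayleigh bounds and the spectral norm. -/

section Rayleigh

variable {d : ℕ} {S : Matrix (Fin d) (Fin d) ℝ}

lemma finite_setOf_hasEigenvalue (S : Matrix (Fin d) (Fin d) ℝ) :
    {μ : ℝ | Module.End.HasEigenvalue (Matrix.toLin' S) μ}.Finite :=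
  Module.End.finite_hasEigenvalue _

lemma posSemidef_of_hasEigenvalue_nonneg (hS : S.IsHermitian)
    (h : ∀ μ, Module.End.HasEigenvalue (Matrix.toLin' S) μ → 0 ≤ μ) : S.PosSemidef := by
  rw [hS.posSemidef_iff_eigenvalues_nonneg]
  intro i
  refine h _ (Module.End.HasEigenvalue.of_mem_spectrum ?_)
  rw [Matrix.spectrum_toLin']
  exact hS.eigenvalues_mem_spectrum_real i

lemma hasEigenvalue_smul_one_add_smul {c e μ : ℝ} (he : e ≠ 0)
    (h : Module.End.HasEigenvalue (Matrix.toLin' (c • 1 + e • S)) μ) :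
    Module.End.HasEigenvalue (Matrix.toLin' S) (e⁻¹ * (μ - c)) := by
  obtain ⟨v, hv⟩ := h.exists_hasEigenvector
  refine Module.End.hasEigenvalue_of_hasEigenvector (x := v) ⟨?_, hv.2⟩
  have h1 := hv.apply_eq_smul
  rw [Module.End.mem_eigenspace_iff]
  simp only [Matrix.toLin'_apply, Matrix.add_mulVec, Matrix.smul_mulVec, Matrix.one_mulVec] at h1 ⊢
  have h2 : e • S.mulVec v = (μ - c) • v := by rw [sub_smul, ← h1]; abel
  rw [mul_smul, ← h2, smul_smul, inv_mul_cancel₀ he, one_smul]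

lemma lambdaMin_mul_le (hS : S.IsHermitian) (v : Fin d → ℝ) :
    lambdaMin S * (v ⬝ᵥ v) ≤ v ⬝ᵥ S.mulVec v := by
  have hP : ((-lambdaMin S) • (1 : Matrix (Fin d) (Fin d) ℝ) + (1 : ℝ) • S).PosSemidef := by
    refine posSemidef_of_hasEigenvalue_nonneg
      ((Matrix.isHermitian_one.smul (.all _)).add (hS.smul (.all _))) fun μ hμ ↦ ?_
    have h := csInf_le (finite_setOf_hasEigenvalue S).bddBelow
      (hasEigenvalue_smul_one_add_smul one_ne_zero hμ)
    change lambdaMin S ≤ _ at h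
    linarith
  have h := hP.dotProduct_mulVec_nonneg v
  rw [Matrix.add_mulVec, Matrix.smul_mulVec, Matrix.smul_mulVec] at h
  simp only [Matrix.one_mulVec, star_trivial, dotProduct_add, dotProduct_smul, smul_eq_mul] at h
  linarith

lemma le_lambdaMax_mul (hS : S.IsHermitian) (v : Fin d → ℝ) :
    v ⬝ᵥ S.mulVec v ≤ lambdaMax S * (v ⬝ᵥ v) := by
  have hP : (lambdaMax S • (1 : Matrix (Fin d) (Fin d) ℝ) + (-1 : ℝ) • S).PosSemidef := by
    refine posSemidef_of_hasEigenvalue_nonneg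
      ((Matrix.isHermitian_one.smul (.all _)).add (hS.smul (.all _))) fun μ hμ ↦ ?_
    have h := le_csSup (finite_setOf_hasEigenvalue S).bddAbove
      (hasEigenvalue_smul_one_add_smul (by norm_num) hμ)
    change _ ≤ lambdaMax S at h
    linarith
  have h := hP.dotProduct_mulVec_nonneg v
  rw [Matrix.add_mulVec, Matrix.smul_mulVec, Matrix.smul_mulVec] at h
  simp only [Matrix.one_mulVec, star_trivial, dotProduct_add, dotProduct_smul, smul_eq_mul] at h
  linarith

lemma lambdaMin_le_lambdaMax (hpos : 0 < lambdaMin S) :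
    lambdaMin S ≤ lambdaMax S := by
  have hne : {μ : ℝ | Module.End.HasEigenvalue (Matrix.toLin' S) μ}.Nonempty := by
    -- In dimension zero there are no eigenvalues and `sInf ∅ = 0`, which `hpos` excludes.
    by_contra h
    rw [lambdaMin, Set.not_nonempty_iff_eq_empty.1 h, Real.sInf_empty] at hpos
    exact hpos.false
  exact csInf_le_csSup hne (finite_setOf_hasEigenvalue S).bddBelow
    (finite_setOf_hasEigenvalue S).bddAbove

open scoped Matrix.Norms.L2Operator in
lemma dotProduct_vecMul_pow_le (A : Matrix (Fin d) (Fin d) ℝ) (v : Fin d → ℝ) (n : ℕ) :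
    Matrix.vecMul v (A ^ n) ⬝ᵥ Matrix.vecMul v (A ^ n) ≤
      (matrixSpectralNorm A ^ n) ^ 2 * (v ⬝ᵥ v) := by
  have hsq (w : Fin d → ℝ) : w ⬝ᵥ w = ‖WithLp.toLp 2 w‖ ^ 2 := by
    rw [EuclideanSpace.real_norm_sq_eq]
    simp [dotProduct, sq]
  have hle : ‖WithLp.toLp 2 (Matrix.vecMul v (A ^ n))‖ ≤
      matrixSpectralNorm A ^ n * ‖WithLp.toLp 2 v‖ := by
    have h1 : Matrix.vecMul v (A ^ n) = (A ^ n).conjTranspose.mulVec v := by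
      rw [Matrix.conjTranspose_eq_transpose_of_trivial, Matrix.mulVec_transpose]
    rw [h1]
    refine (Matrix.l2_opNorm_mulVec _ (WithLp.toLp 2 v)).trans ?_
    rw [Matrix.l2_opNorm_conjTranspose]
    gcongr
    change ‖Matrix.toEuclideanCLM (n := Fin d) (𝕜 := ℝ) (A ^ n)‖ ≤ _
    rw [map_pow]
    -- The identity has norm `0`, not `1`, in dimension zero, so the zeroth power is treated apart.
    rcases n.eq_zero_or_pos with rfl | hn
    · rw [pow_zero, pow_zero]
      exact ContinuousLinearMap.norm_id_le
    · exact norm_pow_le' _ hn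
  rw [hsq, hsq, ← mul_pow]
  gcongr

end Rayleigh

/-! ### Linear spans of the process. -/

section LinearSpan

variable {Ω : Type*} {d : ℕ}

/-- The linear space spanned by the variables `X t`, `t ∈ T`. -/
def linSpan (X : ℤ → Ω → Fin d → ℝ) (T : Set ℤ) : Submodule ℝ (Ω → ℝ) :=
  Submodule.span ℝ {ξ | ∃ t ∈ T, ∃ v : Fin d → ℝ, ξ = fun ω ↦ v ⬝ᵥ X t ω}

variable {X : ℤ → Ω → Fin d → ℝ} {T : Set ℤ}

lemma dotProduct_mem_linSpan {t : ℤ} (ht : t ∈ T) (v : Fin d → ℝ) :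
    (fun ω ↦ v ⬝ᵥ X t ω) ∈ linSpan X T :=
  Submodule.subset_span ⟨t, ht, v, rfl⟩

lemma linSpan_mono {T' : Set ℤ} (h : T ⊆ T') : linSpan X T ≤ linSpan X T' :=
  Submodule.span_mono fun _ ⟨t, ht, v, hv⟩ ↦ ⟨t, h ht, v, hv⟩

lemma sigmaGen_le_iSup_linSpan : sigmaGen X T ≤
    ⨆ ξ : linSpan X T, MeasurableSpace.comap (ξ : Ω → ℝ) inferInstance := by
  refine iSup₂_le fun t ht ↦ ?_
  rw [MeasurableSpace.pi, MeasurableSpace.comap_iSup]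
  refine iSup_le fun i ↦ ?_
  rw [MeasurableSpace.comap_comp]
  refine le_iSup_of_le ⟨_, dotProduct_mem_linSpan ht (Pi.single i 1)⟩ (le_of_eq ?_)
  congr 1
  ext ω
  simp

variable [mΩ : MeasurableSpace Ω] {P : Measure Ω}

/-- The variance of `t • ξ + η` is a nonnegative quadratic in `t`, so its discriminant is
nonpositive. -/
lemma covariance_sq_le [IsFiniteMeasure P] {ξ η : Ω → ℝ} (hξ : MemLp ξ 2 P) (hη : MemLp η 2 P) :
    cov[ξ, η; P] ^ 2 ≤ Var[ξ; P] * Var[η; P] := by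
  have h := discrim_le_zero (a := Var[ξ; P]) (b := 2 * cov[ξ, η; P]) (c := Var[η; P]) fun t ↦ by
    have h0 := variance_nonneg (t • ξ + η) P
    rw [variance_add (hξ.const_smul t) hη, variance_smul, covariance_smul_left] at h0
    linarith
  rw [discrim] at h
  linarith

lemma covariance_congr_ae {ξ ξ' η η' : Ω → ℝ} (h : ξ =ᵐ[P] ξ') (h' : η =ᵐ[P] η') :
    cov[ξ, η; P] = cov[ξ', η'; P] := by
  rw [covariance, covariance, integral_congr_ae h, integral_congr_ae h']
  refine integral_congr_ae ?_
  filter_upwards [h, h'] with ω h1 h2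
  rw [h1, h2]

lemma measurable_of_mem_linSpan (hX : ∀ t, Measurable (X t)) {ξ : Ω → ℝ}
    (hξ : ξ ∈ linSpan X T) : Measurable ξ := by
  induction hξ using Submodule.span_induction with
  | mem ξ h =>
    obtain ⟨t, -, v, rfl⟩ := h
    have := hX t
    simp only [dotProduct]
    fun_prop
  | zero => exact measurable_zero
  | add ξ η _ _ h1 h2 => exact h1.add h2
  | smul c ξ _ h => exact h.const_smul c

lemma hasGaussianLaw_of_mem_linSpan (hX : IsGaussianProcess X P) {ξ : Ω → ℝ}
    (hξ : ξ ∈ linSpan X T) : HasGaussianLaw ξ P := by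
  have hY : IsGaussianProcess (fun (p : ℤ × (Fin d → ℝ)) ω ↦ p.2 ⬝ᵥ X p.1 ω) P :=
    hX.of_isGaussianProcess fun p ↦ ⟨{p.1},
      ∑ i, p.2 i • (ContinuousLinearMap.proj (R := ℝ) (φ := fun _ : Fin d ↦ ℝ) i).comp
        (ContinuousLinearMap.proj (R := ℝ) (φ := fun _ : ({p.1} : Finset ℤ) ↦ Fin d → ℝ)
          ⟨p.1, by simp⟩),
      fun ω ↦ by simp [dotProduct]⟩
  obtain ⟨n, c, g, rfl⟩ := (Submodule.mem_span_set' ..).1 hξ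
  choose t _ v hv using fun i ↦ (g i).2
  have hsum : ∑ i, c i • (g i : Ω → ℝ) =
      ∑ i, fun ω ↦ c i • ((fun (p : ℤ × (Fin d → ℝ)) ω ↦ p.2 ⬝ᵥ X p.1 ω) ∘
        fun i ↦ (t i, v i)) i ω := by
    refine Finset.sum_congr rfl fun i _ ↦ ?_
    rw [hv i]
    rfl
  rw [hsum]
  exact ((hY.comp_right fun i ↦ (t i, v i)).smul c).hasGaussianLaw_sum (I := Finset.univ)

end LinearSpan

/-! ### Causality, the linear Markov property and the mixing bound. -/

section VAR

variable {Ω : Type*} [MeasurableSpace Ω] {P : Measure Ω} {d : ℕ}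
  {A : Matrix (Fin d) (Fin d) ℝ} {X E : ℤ → Ω → Fin d → ℝ}

lemma variance_dotProduct_of_memLp [IsFiniteMeasure P] {Y : Ω → Fin d → ℝ}
    (hY : ∀ i, MemLp (fun ω ↦ Y ω i) 2 P) (v : Fin d → ℝ) :
    Var[fun ω ↦ v ⬝ᵥ Y ω; P] = v ⬝ᵥ (covMatrix P Y).mulVec v := by
  have e : (fun ω ↦ v ⬝ᵥ Y ω) = ∑ i, v i • fun ω ↦ Y ω i := by
    ext ω
    simp [dotProduct]
  rw [e, variance_sum_smul hY]
  simp only [dotProduct, Matrix.mulVec, Finset.mul_sum, covMatrix, Matrix.of_apply]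
  exact Finset.sum_congr rfl fun i _ ↦ Finset.sum_congr rfl fun j _ ↦ by ring

lemma isHermitian_covMatrix (Y : Ω → Fin d → ℝ) : (covMatrix P Y).IsHermitian := by
  ext i j
  simp [covMatrix, covariance_comm]

namespace IsStationaryGaussianVAR

variable (h : IsStationaryGaussianVAR P A X E)
include h

lemma memLp_of_mem_linSpan {T : Set ℤ} {ξ : Ω → ℝ} (hξ : ξ ∈ linSpan X T) : MemLp ξ 2 P :=
  (hasGaussianLaw_of_mem_linSpan h.gaussian_process hξ).memLp_two

lemma memLp_dotProduct (t : ℤ) (v : Fin d → ℝ) : MemLp (fun ω ↦ v ⬝ᵥ X t ω) 2 P :=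
  h.memLp_of_mem_linSpan (dotProduct_mem_linSpan (Set.mem_univ t) v)

lemma memLp_dotProduct_innovation (t : ℤ) (v : Fin d → ℝ) :
    MemLp (fun ω ↦ v ⬝ᵥ E t ω) 2 P := by
  have := (h.gaussian_innovation t).map_fun
    (∑ i, v i • ContinuousLinearMap.proj (R := ℝ) (φ := fun _ : Fin d ↦ ℝ) i)
  simpa [dotProduct] using this.memLp_two

lemma variance_dotProduct [IsProbabilityMeasure P] (t : ℤ) (v : Fin d → ℝ) :
    Var[fun ω ↦ v ⬝ᵥ X t ω; P] = v ⬝ᵥ (covMatrix P (X 0)).mulVec v := by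
  have hmeas : Measurable fun x : Fin d → ℝ ↦ v ⬝ᵥ x := by
    simp only [dotProduct]
    fun_prop
  have hid : IdentDistrib (fun ω ↦ v ⬝ᵥ X t ω) (fun ω ↦ v ⬝ᵥ X 0 ω) P P := by
    have := (h.stationary t).comp (u := fun x : ℤ → Fin d → ℝ ↦ v ⬝ᵥ x 0)
      (hmeas.comp (measurable_pi_apply 0))
    simpa [Function.comp_def] using this
  rw [hid.variance_eq, variance_dotProduct_of_memLp]
  intro i
  simpa using h.memLp_dotProduct 0 (Pi.single i 1)

lemma dotProduct_recursion (t : ℤ) (v : Fin d → ℝ) :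
    (fun ω ↦ v ⬝ᵥ X t ω) =ᵐ[P]
      (fun ω ↦ Matrix.vecMul v A ⬝ᵥ X (t - 1) ω) + fun ω ↦ v ⬝ᵥ E t ω := by
  filter_upwards [h.recursion t] with ω hω
  rw [hω, dotProduct_add, Matrix.dotProduct_mulVec]
  rfl

lemma covariance_innovation_eq_zero [IsProbabilityMeasure P] {s t : ℤ} (hst : s ≠ t)
    (v w : Fin d → ℝ) : cov[fun ω ↦ v ⬝ᵥ E s ω, fun ω ↦ w ⬝ᵥ E t ω; P] = 0 := by
  have hmeas (v : Fin d → ℝ) : Measurable fun x : Fin d → ℝ ↦ v ⬝ᵥ x := by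
    simp only [dotProduct]
    fun_prop
  exact ((h.indep_innovation.indepFun hst).comp (hmeas v) (hmeas w)).covariance_eq_zero
    (h.memLp_dotProduct_innovation s v) (h.memLp_dotProduct_innovation t w)

/-- If the transition matrix is a strict contraction, then the process is causal: its past is
uncorrelated with the innovations. -/
lemma covariance_past_innovation_eq_zero [IsProbabilityMeasure P]
    (hA : matrixSpectralNorm A < 1) {r t : ℤ} (hrt : r < t) (v w : Fin d → ℝ) :
    cov[fun ω ↦ v ⬝ᵥ X r ω, fun ω ↦ w ⬝ᵥ E t ω; P] = 0 := by
  -- Going back in time only adds innovations earlier than `t`, uncorrelated with `E t`. By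
  -- stationarity the variance of the remaining term decays geometrically.
  have step (n : ℕ) : cov[fun ω ↦ v ⬝ᵥ X r ω, fun ω ↦ w ⬝ᵥ E t ω; P] =
      cov[fun ω ↦ Matrix.vecMul v (A ^ n) ⬝ᵥ X (r - n) ω, fun ω ↦ w ⬝ᵥ E t ω; P] := by
    induction n with
    | zero => simp
    | succ n ih =>
      rw [ih, covariance_congr_ae (h.dotProduct_recursion (r - n) _) Filter.EventuallyEq.rfl,
        covariance_add_left (h.memLp_dotProduct _ _) (h.memLp_dotProduct_innovation _ _)
          (h.memLp_dotProduct_innovation _ _),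
        h.covariance_innovation_eq_zero (by omega), add_zero, Matrix.vecMul_vecMul, ← pow_succ]
      simp [sub_sub]
  set L := lambdaMax (covMatrix P (X 0))
  set V := Var[fun ω ↦ w ⬝ᵥ E t ω; P]
  have ha : 0 ≤ matrixSpectralNorm A := norm_nonneg _
  have hbound (n : ℕ) : cov[fun ω ↦ v ⬝ᵥ X r ω, fun ω ↦ w ⬝ᵥ E t ω; P] ^ 2 ≤
      |L| * ((matrixSpectralNorm A ^ n) ^ 2 * (v ⬝ᵥ v)) * V := by
    rw [step n]
    refine (covariance_sq_le (h.memLp_dotProduct _ _)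
      (h.memLp_dotProduct_innovation _ _)).trans ?_
    refine mul_le_mul_of_nonneg_right ?_ (variance_nonneg _ _)
    rw [h.variance_dotProduct]
    refine (le_lambdaMax_mul (isHermitian_covMatrix _) _).trans ?_
    have hnn : 0 ≤ Matrix.vecMul v (A ^ n) ⬝ᵥ Matrix.vecMul v (A ^ n) := by
      simpa using dotProduct_star_self_nonneg (Matrix.vecMul v (A ^ n))
    exact mul_le_mul (le_abs_self L) (dotProduct_vecMul_pow_le A v n) hnn (abs_nonneg L)
  have hlim : Filter.Tendsto (fun n : ℕ ↦ |L| * ((matrixSpectralNorm A ^ n) ^ 2 * (v ⬝ᵥ v)) * V)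
      Filter.atTop (nhds 0) := by
    have h0 := tendsto_pow_atTop_nhds_zero_of_lt_one ha hA
    simpa using ((((h0.pow 2).mul_const (v ⬝ᵥ v)).const_mul |L|).mul_const V)
  have hle := ge_of_tendsto' hlim hbound
  exact pow_eq_zero_iff (two_ne_zero) |>.1 (le_antisymm hle (sq_nonneg _))

/-- Each use of the recursion multiplies `v` by `A` and leaves an innovation later than `s`, which
is uncorrelated with `ξ` by causality. -/
lemma covariance_dotProduct_add [IsProbabilityMeasure P] (hA : matrixSpectralNorm A < 1) {s : ℤ}
    {ξ : Ω → ℝ} (hξ : ξ ∈ linSpan X (Set.Iic s)) (k : ℕ) (v : Fin d → ℝ) :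
    cov[ξ, fun ω ↦ v ⬝ᵥ X (s + k) ω; P] =
      cov[ξ, fun ω ↦ Matrix.vecMul v (A ^ k) ⬝ᵥ X s ω; P] := by
  have hinn {t : ℤ} (hst : s < t) (w : Fin d → ℝ) : cov[ξ, fun ω ↦ w ⬝ᵥ E t ω; P] = 0 := by
    have hw := h.memLp_dotProduct_innovation t w
    induction hξ using Submodule.span_induction with
    | mem ξ hξ =>
      obtain ⟨r, hr, u, rfl⟩ := hξ
      exact h.covariance_past_innovation_eq_zero hA (lt_of_le_of_lt hr hst) u w
    | zero => exact covariance_zero_left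
    | add ξ η h1 h2 ih1 ih2 =>
      rw [covariance_add_left (h.memLp_of_mem_linSpan h1) (h.memLp_of_mem_linSpan h2) hw, ih1, ih2,
        add_zero]
    | smul c ξ h1 ih => rw [covariance_smul_left, ih, mul_zero]
  induction k generalizing v with
  | zero => simp
  | succ k ih =>
    have hk : s + (k + 1 : ℕ) - 1 = s + k := by push_cast; ring
    rw [covariance_congr_ae Filter.EventuallyEq.rfl (h.dotProduct_recursion _ v),
      covariance_add_right (h.memLp_of_mem_linSpan hξ) (h.memLp_dotProduct _ _)
        (h.memLp_dotProduct_innovation _ _), hinn (by push_cast; omega), add_zero, pow_succ',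
      ← Matrix.vecMul_vecMul, ← ih, hk]

/-- Linear Markov property: with respect to the variables up to time `s`, every variable from time
`s` on has the same covariances as a linear function of the state at time `s`. -/
lemma exists_covariance_eq [IsProbabilityMeasure P] (hA : matrixSpectralNorm A < 1) {s : ℤ}
    {η : Ω → ℝ} (hη : η ∈ linSpan X (Set.Ici s)) :
    ∃ v : Fin d → ℝ, ∀ ξ ∈ linSpan X (Set.Iic s),
      cov[ξ, η; P] = cov[ξ, fun ω ↦ v ⬝ᵥ X s ω; P] := by
  induction hη using Submodule.span_induction with
  | mem η hη =>
    obtain ⟨t, ht, v, rfl⟩ := hη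
    obtain ⟨k, rfl⟩ := Int.le.dest ht
    exact ⟨_, fun ξ hξ ↦ h.covariance_dotProduct_add hA hξ k v⟩
  | zero => exact ⟨0, fun ξ _ ↦ by simp⟩
  | add η η' h1 h2 ih1 ih2 =>
    obtain ⟨v, hv⟩ := ih1
    obtain ⟨v', hv'⟩ := ih2
    refine ⟨v + v', fun ξ hξ ↦ ?_⟩
    have hL := h.memLp_of_mem_linSpan hξ
    simp only [add_dotProduct]
    rw [covariance_add_right hL (h.memLp_of_mem_linSpan h1) (h.memLp_of_mem_linSpan h2), hv ξ hξ,
      hv' ξ hξ]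
    exact (covariance_add_right hL (h.memLp_dotProduct _ _) (h.memLp_dotProduct _ _)).symm
  | smul c η _ ih =>
    obtain ⟨v, hv⟩ := ih
    refine ⟨c • v, fun ξ hξ ↦ ?_⟩
    simp only [smul_dotProduct]
    rw [covariance_smul_right, hv ξ hξ]
    exact (covariance_smul_right c).symm

lemma covariance_sq_le_of_mem_linSpan [IsProbabilityMeasure P] (hA : matrixSpectralNorm A < 1)
    (hpos : 0 < lambdaMin (covMatrix P (X 0))) {j : ℤ} {m : ℕ} {ξ η : Ω → ℝ}
    (hξ : ξ ∈ linSpan X (Set.Iic j)) (hη : η ∈ linSpan X (Set.Ici (j + m))) :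
    cov[ξ, η; P] ^ 2 ≤
      (lambdaMax (covMatrix P (X 0)) / lambdaMin (covMatrix P (X 0)) *
        (matrixSpectralNorm A ^ m) ^ 2) * (Var[ξ; P] * Var[η; P]) := by
  set S := covMatrix P (X 0)
  have hS : S.IsHermitian := isHermitian_covMatrix _
  have hmax : 0 < lambdaMax S := hpos.trans_le (lambdaMin_le_lambdaMax hpos)
  have hLξ := h.memLp_of_mem_linSpan hξ
  have hLη := h.memLp_of_mem_linSpan hη
  obtain ⟨v, hv⟩ := h.exists_covariance_eq hA hη
  -- Taking `ξ = v ⬝ᵥ X (j + m)` in `hv` shows that its covariance with `η` is its own variance, as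
  -- for an orthogonal projection. Cauchy–Schwarz then bounds that variance.
  have hvar : Var[fun ω ↦ v ⬝ᵥ X (j + m) ω; P] ≤ Var[η; P] := by
    have h1 := covariance_sq_le (h.memLp_dotProduct (j + m) v) hLη
    rw [hv _ (dotProduct_mem_linSpan Set.self_mem_Iic v),
      covariance_self (h.memLp_dotProduct _ _).aemeasurable, sq] at h1
    rcases (variance_nonneg (fun ω ↦ v ⬝ᵥ X (j + m) ω) P).eq_or_lt with h0 | h0
    · rw [← h0]
      exact variance_nonneg _ _
    · exact le_of_mul_le_mul_left h1 h0
  rw [hv ξ (linSpan_mono (Set.Iic_subset_Iic.2 (by omega)) hξ),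
    h.covariance_dotProduct_add hA hξ]
  refine (covariance_sq_le hLξ (h.memLp_dotProduct _ _)).trans ?_
  rw [mul_left_comm]
  refine mul_le_mul_of_nonneg_left ?_ (variance_nonneg _ _)
  rw [h.variance_dotProduct] at hvar ⊢
  have hvv : v ⬝ᵥ v ≤ Var[η; P] / lambdaMin S := by
    rw [le_div_iff₀' hpos]
    exact (lambdaMin_mul_le hS v).trans hvar
  calc _ ≤ lambdaMax S * (Matrix.vecMul v (A ^ m) ⬝ᵥ Matrix.vecMul v (A ^ m)) :=
        le_lambdaMax_mul hS _
    _ ≤ lambdaMax S * ((matrixSpectralNorm A ^ m) ^ 2 * (Var[η; P] / lambdaMin S)) := by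
        have := dotProduct_vecMul_pow_le A v m
        gcongr
        exact this.trans (by gcongr)
    _ = _ := by ring

lemma alphaMixing_le [IsProbabilityMeasure P] (hpos : 0 < lambdaMin (covMatrix P (X 0)))
    (m : ℕ) :
    alphaMixing P X m ≤
      Real.sqrt (lambdaMax (covMatrix P (X 0)) / lambdaMin (covMatrix P (X 0))) *
        matrixSpectralNorm A ^ m := by
  set ρ := Real.sqrt (lambdaMax (covMatrix P (X 0)) / lambdaMin (covMatrix P (X 0))) *
    matrixSpectralNorm A ^ m with hρ
  have hcond : 1 ≤ lambdaMax (covMatrix P (X 0)) / lambdaMin (covMatrix P (X 0)) :=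
    (one_le_div hpos).2 (lambdaMin_le_lambdaMax hpos)
  have ha : 0 ≤ matrixSpectralNorm A := norm_nonneg _
  have hρ0 : 0 ≤ ρ := by positivity
  refine ciSup_le fun j ↦ csSup_le ⟨_, ∅, ∅, MeasurableSpace.measurableSet_empty _,
    MeasurableSpace.measurableSet_empty _, rfl⟩ ?_
  rintro _ ⟨U, V, hU, hV, rfl⟩
  rcases le_or_gt 1 (matrixSpectralNorm A) with hA | hA
  · exact (abs_measureReal_inter_sub_le_one U V).trans
      (one_le_mul_of_one_le_of_one_le (Real.one_le_sqrt.2 hcond) (one_le_pow₀ hA))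
  refine abs_measureReal_inter_sub_le (G := linSpan X Set.univ) (H₁ := linSpan X (Set.Iic j))
    (H₂ := linSpan X (Set.Ici (j + m)))
    (fun ξ hξ ↦ measurable_of_mem_linSpan h.measurable_process hξ)
    (fun ξ hξ ↦ hasGaussianLaw_of_mem_linSpan h.gaussian_process hξ)
    (linSpan_mono (Set.subset_univ _)) (linSpan_mono (Set.subset_univ _)) hρ0
    (fun ξ hξ η hη ↦ ?_) (sigmaGen_le_iSup_linSpan _ hU) (sigmaGen_le_iSup_linSpan _ hV)
  have hsq := h.covariance_sq_le_of_mem_linSpan hA hpos hξ hη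
  have hρsq : ρ ^ 2 = lambdaMax (covMatrix P (X 0)) / lambdaMin (covMatrix P (X 0)) *
      (matrixSpectralNorm A ^ m) ^ 2 := by
    rw [hρ, mul_pow, Real.sq_sqrt (by linarith)]
  rw [← hρsq] at hsq
  have hξ0 := variance_nonneg ξ P
  have hη0 := variance_nonneg η P
  refine le_of_abs_le (abs_le_of_sq_le_sq ?_ (by positivity))
  -- The arithmetic–geometric mean inequality for the two variances.
  nlinarith [mul_nonneg (sq_nonneg ρ) (sq_nonneg (Var[ξ; P] - Var[η; P]))]

end IsStationaryGaussianVAR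

end VAR

end GaussianVAR

theorem theorem3p1 {Ω : Type*} [MeasurableSpace Ω] (P : Measure Ω) [IsProbabilityMeasure P]
    (d : ℕ → ℕ) (A : (n : ℕ) → Matrix (Fin (d n)) (Fin (d n)) ℝ)
    (X E : (n : ℕ) → ℤ → Ω → Fin (d n) → ℝ) (n : ℕ)
    (hVAR : GaussianVAR.IsStationaryGaussianVAR P (A n) (X n) (E n))
    (hpos : 0 < GaussianVAR.lambdaMin (GaussianVAR.covMatrix P (X n 0)))
    (m : ℕ) (hm : 1 ≤ m) :
    GaussianVAR.alphaMixing P (X n) m ≤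
      Real.sqrt (GaussianVAR.lambdaMax (GaussianVAR.covMatrix P (X n 0)) /
          GaussianVAR.lambdaMin (GaussianVAR.covMatrix P (X n 0))) *
        GaussianVAR.matrixSpectralNorm (A n) ^ m :=
  hVAR.alphaMixing_le hpos m
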